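/- **Setting.** A *timed automaton game* $\mathcal A$ has finite sets $L$ of locations and $C$ of clocks, disjoint sets $A_1,A_2$ of actions, a set $E$ of edges $\langle l,a,\theta,l',\lambda\rangle$ with $a\in A_1\cup A_2$, guard $\theta$ and reset set $\lambda\subseteq C$ (different edges from the same location have different actions), and an invariant for every location; guards and invariants are built from $x\le d$, $d\le x$ ($x\in C$, $d\in\mathbb N$) by $\neg$ and $\wedge$. A state is a pair $\langle l,\kappa\rangle$ with $\kappa:C\to\mathbb R_{\ge0}$ satisfying the invariant of $l$. A move of player $i$ is $\langle\Delta,a\rangle$ with $\Delta\ge0$ and $a\in A_i\cup\{\bot_i\}$. It is available at $\langle l,\kappa\rangle$, written $\langle\Delta,a\rangle\in\Gamma_i(\langle l,\kappa\rangle)$, if $\kappa+\Delta'$ satisfies the invariant of $l$ for all $0\le\Delta'\le\Delta$ and, when $a\ne\bot_i$, an edge $\langle l,a,\theta,l',\lambda\rangle$ exists such that $\kappa+\Delta$ satisfies $\theta$ and $(\kappa+\Delta)[\lambda:=0]$ satisfies the invariant of $l'$; its successor $\delta(s,\langle\Delta,a\rangle)$ is $\langle l,\kappa+\Delta\rangle$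 if $a=\bot_i$ and $\langle l',(\kappa+\Delta)[\lambda:=0]\rangle$ otherwise. When $m_1=\langle\Delta_1,a_1\rangle$ and $m_2=\langle\Delta_2,a_2\rangle$ are proposed at $s$, the next state is $\delta(s,m_2)$ if $a_1=\bot_1$ or $\Delta_2<\Delta_1$, it is $\delta(s,m_1)$ if $a_1\ne\bot_1$ and $\Delta_1<\Delta_2$, and it is either of the two if $a_1\neq\bot_1$ and $\Delta_1=\Delta_2$. The elapsed time is $\min(\Delta_1,\Delta_2)$. Player 1 is responsible for the change to $s'$ if $\Delta_1\le\Delta_2$, $\delta(s,m_1)=s'$ and $a_1\ne\bot_1$; player 2 is if $\Delta_2\le\Delta_1$ and $\delta(s,m_2)=s'$. A run is an infinite sequence of states and pairs of available moves that follows these rules; an *objective* $\Phi$ is a set of runs. Let $\mathrm{td}$ be the set of runs whose total elapsed time is infinite and $\mathrm{blameless}_i$ the set of runs in which player $i$ is responsible for finitely many steps only. A (exact) strategy of player $i$ assigns an available move to every finite run prefix. The outcomes from $s$ under two strategies are the runs from $s$ in which the players make the moves that their strategies propose. A strategy of player $i$ is *receptive* if all its outcomes, from all states and against all strategies of the opponent,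 are in $\mathrm{td}\cup\mathrm{blameless}_i$. A game is *well-formed* if both players have receptive strategies. * $\mathrm{WinTimeDiv}_1(\Phi)$ is the set of states $s$ from which player 1 has a receptive strategy all of whose outcomes from $s$, against every receptive strategy of player 2, lie in $\Phi$. * A *limit-robust strategy* of player 1 assigns to every run prefix either an available $\langle\Delta,\bot_1\rangle$ or some $\langle[\alpha,\beta],a_1\rangle$ with $\alpha<\beta$, $a_1\in A_1$, such that $\langle\Delta,a_1\rangle$ is available for every $\Delta\in[\alpha,\beta]$; in the outcomes, the actual move is any such $\langle\Delta,a_1\rangle$. $\mathrm{RobWinTimeDiv}_1(\Phi)$ is defined like $\mathrm{WinTimeDiv}_1(\Phi)$ with limit-robust strategies of player 1 (receptiveness and winning refer to their outcomes) against exact receptive strategies of player 2. * For jitter $\varepsilon$ and response time $\varrho$, a *bounded-robust strategy* of player 1 assigns to every run prefix $h$, ending in $s$, either an available $\langle\Delta,\bot_1\rangle$ or some $\langle\Delta,a_1\rangle$, $a_1\in A_1$, with $\Delta\ge\max(0,\varrho-\tau(h))$ and $\langle\Delta',a_1\rangle\in\Gamma_1(s)$ for all $\Delta'\in[\Delta,\Delta+\varepsilon]$.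 Here $\tau(h)$ is the elapsed time of the longest block of consecutive steps at the end of $h$ in which player 2 proposed a move with action $\bot_2$ and was responsible. In the outcomes, the actual move is $\langle\Delta,\bot_1\rangle$, respectively $\langle\Delta+e,a_1\rangle$ for any $e\in[0,\varepsilon]$. $\mathrm{JRWinTimeDiv}_1^{\varepsilon,\varrho}(\Phi)$ is defined like $\mathrm{WinTimeDiv}_1(\Phi)$ with bounded-robust strategies of player 1 (receptiveness and winning refer to their outcomes) against exact receptive strategies of player 2. **Theorem.** For every timed automaton game, every objective $\Phi$, and all reals $\varepsilon>0$ and $\varrho\ge0$, $$\mathrm{JRWinTimeDiv}_1^{\varepsilon,\varrho}(\Phi)\subseteq\mathrm{RobWinTimeDiv}_1(\Phi)\subseteq\mathrm{WinTimeDiv}_1(\Phi).$$ Both inclusions are strict in general. Let $\mathcal A$ have locations $l^0,l^1,l^2,l^3$, clocks $x,y$, all invariants true, the player-1 edges $l^0\xrightarrow{a_1^1,\;x\le1,\;x:=0}l^1$, $\;l^1\xrightarrow{a_1^2,\;y>1,\;y:=0}l^0$, $\;l^0\xrightarrow{a_1^3,\;\mathrm{true}}l^2$, $\;l^2\xrightarrow{a_1^4,\;\mathrm{true}}l^0$,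 and the player-2 edges $l^0\xrightarrow{a_2^1,\;x>1}l^3$, $\;l^1\xrightarrow{a_2^2,\;x>1}l^3$, $\;l^2\xrightarrow{a_2^3,\;x>1}l^3$ (no resets where none are shown). Let $\Phi=\Box(\neg l^3)$, the set of runs that never visit $l^3$. Then $\mathcal A$ is well-formed; $\Phi$ is the parity objective ("the maximal index visited infinitely often is even") for the index function that is $1$ at $l^3$ and $0$ elsewhere; and for all $\varepsilon>0$ and $\varrho\ge0$, $$\mathrm{JRWinTimeDiv}_1^{\varepsilon,\varrho}(\Phi)\subsetneq\mathrm{RobWinTimeDiv}_1(\Phi)\subsetneq\mathrm{WinTimeDiv}_1(\Phi),$$ where $\langle l^0,x=y=0\rangle\in\mathrm{RobWinTimeDiv}_1(\Phi)\setminus\mathrm{JRWinTimeDiv}_1^{\varepsilon,\varrho}(\Phi)$ and $\langle l^0,x=y=1\rangle\in\mathrm{WinTimeDiv}_1(\Phi)\setminus\mathrm{RobWinTimeDiv}_1(\Phi)$. -/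

import Mathlib

open scoped NNReal

namespace TimedGames

/-! ### Timed game structures -/

/-- A move `⟨Δ, a⟩` of a player with action set `A`: wait `Δ` time units, then take `a`.
The value `none` is the pure time action `⊥` of that player. -/
structure Move (A : Type*) where
  delay : ℝ≥0
  act : Option A

/-- Timed game structures with state space `S`. The action sets of the players are two separate
types, so they are disjoint; `δ₁`, `δ₂` are the transition function on the moves of player 1
and of player 2 (their values at moves that are not available are irrelevant). -/
structure TimedGame (S A₁ A₂ : Type*) where
  Γ₁ : S → Set (Move A₁)
  Γ₂ : S → Set (Move A₂)
  δ₁ : S → Move A₁ → S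
  δ₂ : S → Move A₂ → S
  stutter₁ : ∀ s, ⟨0, none⟩ ∈ Γ₁ s
  stutter₂ : ∀ s, ⟨0, none⟩ ∈ Γ₂ s
  split₁ : ∀ s (Δ Δ' : ℝ≥0) a, Δ' ≤ Δ → (⟨Δ, a⟩ ∈ Γ₁ s ↔
    ⟨Δ', none⟩ ∈ Γ₁ s ∧ ⟨Δ - Δ', a⟩ ∈ Γ₁ (δ₁ s ⟨Δ', none⟩))
  split₂ : ∀ s (Δ Δ' : ℝ≥0) a, Δ' ≤ Δ → (⟨Δ, a⟩ ∈ Γ₂ s ↔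
    ⟨Δ', none⟩ ∈ Γ₂ s ∧ ⟨Δ - Δ', a⟩ ∈ Γ₂ (δ₂ s ⟨Δ', none⟩))
  comp₁ : ∀ s (Δ Δ' : ℝ≥0) a, Δ' ≤ Δ → ⟨Δ, a⟩ ∈ Γ₁ s →
    δ₁ (δ₁ s ⟨Δ', none⟩) ⟨Δ - Δ', a⟩ = δ₁ s ⟨Δ, a⟩
  comp₂ : ∀ s (Δ Δ' : ℝ≥0) a, Δ' ≤ Δ → ⟨Δ, a⟩ ∈ Γ₂ s →
    δ₂ (δ₂ s ⟨Δ', none⟩) ⟨Δ - Δ', a⟩ = δ₂ s ⟨Δ, a⟩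

/-- Finite alternating sequences of states and pairs of moves. -/
inductive Prefix (S A₁ A₂ : Type*) where
  | start (s : S) : Prefix S A₁ A₂
  | snoc (h : Prefix S A₁ A₂) (m₁ : Move A₁) (m₂ : Move A₂) (s : S) : Prefix S A₁ A₂

/-- The last state of a finite sequence. -/
def Prefix.last {S A₁ A₂ : Type*} : Prefix S A₁ A₂ → S
  | .start s => s
  | .snoc _ _ _ s => s

/-- The time that elapses when two moves are proposed. -/
def elapsed {A₁ A₂ : Type*} (m₁ : Move A₁) (m₂ : Move A₂) : ℝ≥0 :=
  min m₁.delay m₂.delay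

namespace TimedGame

variable {S A₁ A₂ : Type*} (G : TimedGame S A₁ A₂)

/-- The joint destination function. If `a₁ = ⊥`, player 2 determines the successor;
otherwise the shorter delay wins, and a tie is resolved nondeterministically. -/
def jd (s : S) (m₁ : Move A₁) (m₂ : Move A₂) : Set S :=
  {s' | (m₁.act ≠ none ∧ m₁.delay ≤ m₂.delay ∧ s' = G.δ₁ s m₁) ∨
        ((m₁.act = none ∨ m₂.delay ≤ m₁.delay) ∧ s' = G.δ₂ s m₂)}

/-- Player 1 is responsible for the state change from `s` to `s'`. -/
def Blame₁ (s : S) (m₁ : Move A₁) (m₂ : Move A₂) (s' : S) : Prop :=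
  m₁.delay ≤ m₂.delay ∧ G.δ₁ s m₁ = s' ∧ m₁.act ≠ none

/-- Player 2 is responsible for the state change from `s` to `s'`. -/
def Blame₂ (s : S) (m₁ : Move A₁) (m₂ : Move A₂) (s' : S) : Prop :=
  m₂.delay ≤ m₁.delay ∧ G.δ₂ s m₂ = s'

/-- Runs: infinite sequences of states and pairs of available moves. -/
structure Run where
  state : ℕ → S
  move₁ : ℕ → Move A₁
  move₂ : ℕ → Move A₂
  avail₁ : ∀ k, move₁ k ∈ G.Γ₁ (state k)
  avail₂ : ∀ k, move₂ k ∈ G.Γ₂ (state k)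
  step : ∀ k, state (k + 1) ∈ G.jd (state k) (move₁ k) (move₂ k)

variable {G}

/-- The run prefix `r[0..k]`. -/
def Run.pre (r : G.Run) : ℕ → Prefix S A₁ A₂
  | 0 => .start (r.state 0)
  | k + 1 => .snoc (r.pre k) (r.move₁ k) (r.move₂ k) (r.state (k + 1))

/-- The time at position `k` of a run. -/
noncomputable def Run.time (r : G.Run) (k : ℕ) : ℝ≥0 :=
  ∑ j ∈ Finset.range k, elapsed (r.move₁ j) (r.move₂ j)

variable (G)

/-- The time-divergent runs. -/
def timeDiv : Set G.Run := {r | Filter.Tendsto r.time Filter.atTop Filter.atTop}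

/-- The runs in which player 1 is responsible for finitely many transitions only. -/
def blameless₁ : Set G.Run :=
  {r | ∃ k, ∀ j ≥ k, ¬ G.Blame₁ (r.state j) (r.move₁ j) (r.move₂ j) (r.state (j + 1))}

/-- The runs in which player 2 is responsible for finitely many transitions only. -/
def blameless₂ : Set G.Run :=
  {r | ∃ k, ∀ j ≥ k, ¬ G.Blame₂ (r.state j) (r.move₁ j) (r.move₂ j) (r.state (j + 1))}

/-- The parity objective: the maximal index visited infinitely often is even. (The index
functions used take finitely many values.) -/
def parity (Ω : S → ℕ) : Set G.Run :=
  {r | Even (sSup {p | ∃ᶠ k in Filter.atTop, Ω (r.state k) = p})}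

/-! ### Exact strategies -/

/-- Strategies of player 1: an available move for every run prefix. (The values at sequences
that are not prefixes of runs play no role.) -/
structure Strategy₁ where
  move : Prefix S A₁ A₂ → Move A₁
  avail : ∀ (r : G.Run) k, move (r.pre k) ∈ G.Γ₁ (r.state k)

/-- Strategies of player 2. -/
structure Strategy₂ where
  move : Prefix S A₁ A₂ → Move A₂
  avail : ∀ (r : G.Run) k, move (r.pre k) ∈ G.Γ₂ (r.state k)

variable {G}

/-- The possible outcomes from the state `s` under two exact strategies. -/
def outcomes (s : S) (π₁ : G.Strategy₁) (π₂ : G.Strategy₂) : Set G.Run :=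
  {r | r.state 0 = s ∧ (∀ k, r.move₁ k = π₁.move (r.pre k)) ∧
    ∀ k, r.move₂ k = π₂.move (r.pre k)}

def Strategy₁.Receptive (π₁ : G.Strategy₁) : Prop :=
  ∀ (π₂ : G.Strategy₂) (s : S), outcomes s π₁ π₂ ⊆ G.timeDiv ∪ G.blameless₁

def Strategy₂.Receptive (π₂ : G.Strategy₂) : Prop :=
  ∀ (π₁ : G.Strategy₁) (s : S), outcomes s π₁ π₂ ⊆ G.timeDiv ∪ G.blameless₂

variable (G)

/-- Both players have receptive strategies. -/
def WellFormed : Prop :=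
  (∃ π₁ : G.Strategy₁, π₁.Receptive) ∧ ∃ π₂ : G.Strategy₂, π₂.Receptive

/-- The exact winning set of player 1. -/
def winTimeDiv (Φ : Set G.Run) : Set S :=
  {s | ∃ π₁ : G.Strategy₁, π₁.Receptive ∧
    ∀ π₂ : G.Strategy₂, π₂.Receptive → outcomes s π₁ π₂ ⊆ Φ}

end TimedGame

/-! ### Limit-robust strategies -/

/-- The shape of a limit-robust move: a pure time move `⟨Δ, ⊥⟩`, or `⟨[α, β], a⟩` with a proper
action `a`. -/
inductive RobMove (A : Type*) where
  | wait (Δ : ℝ≥0) : RobMove A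
  | interval (α β : ℝ≥0) (a : A) : RobMove A

/-- The exact moves that a limit-robust move may turn into. -/
def RobMove.realizations {A : Type*} : RobMove A → Set (Move A)
  | .wait Δ => {⟨Δ, none⟩}
  | .interval α β a => {m | ∃ Δ ∈ Set.Icc α β, m = ⟨Δ, some a⟩}

/-- The interval of a limit-robust move has more than one point. -/
def RobMove.NonDegenerate {A : Type*} : RobMove A → Prop
  | .wait _ => True
  | .interval α β _ => α < β

namespace TimedGame

variable {S A₁ A₂ : Type*} (G : TimedGame S A₁ A₂)

/-- The limit-robust moves of player 1 at a state. -/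
def robMoves (s : S) : Set (RobMove A₁) :=
  {m | m.NonDegenerate ∧ m.realizations ⊆ G.Γ₁ s}

/-- Limit-robust strategies of player 1. -/
structure RobStrategy where
  move : Prefix S A₁ A₂ → RobMove A₁
  avail : ∀ (r : G.Run) k, move (r.pre k) ∈ G.robMoves (r.state k)

variable {G}

/-- The possible outcomes from `s` under a limit-robust strategy of player 1. -/
def robOutcomes (s : S) (π₁ : G.RobStrategy) (π₂ : G.Strategy₂) : Set G.Run :=
  {r | r.state 0 = s ∧ (∀ k, r.move₁ k ∈ (π₁.move (r.pre k)).realizations) ∧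
    ∀ k, r.move₂ k = π₂.move (r.pre k)}

def RobStrategy.Receptive (π₁ : G.RobStrategy) : Prop :=
  ∀ (π₂ : G.Strategy₂) (s : S), robOutcomes s π₁ π₂ ⊆ G.timeDiv ∪ G.blameless₁

variable (G)

/-- The limit-robust winning set of player 1. -/
def robWinTimeDiv (Φ : Set G.Run) : Set S :=
  {s | ∃ π₁ : G.RobStrategy, π₁.Receptive ∧
    ∀ π₂ : G.Strategy₂, π₂.Receptive → robOutcomes s π₁ π₂ ⊆ Φ}

/-! ### Bounded-robust strategies -/

open Classical in
/-- The time that has passed due to the longest contiguous sequence of pure time moves of player 2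
at the end of a run prefix. -/
noncomputable def timeElapse : Prefix S A₁ A₂ → ℝ≥0
  | .start _ => 0
  | .snoc h m₁ m₂ s =>
      if m₂.act = none ∧ G.Blame₂ h.last m₁ m₂ s then timeElapse h + elapsed m₁ m₂ else 0

/-- The moves that an `ε`-jitter `ρ`-response strategy may propose after the run prefix `h`. -/
def jrMoves (ε ρ : ℝ≥0) (h : Prefix S A₁ A₂) : Set (Move A₁) :=
  {m | (m.act = none ∧ m ∈ G.Γ₁ h.last) ∨
    (m.act ≠ none ∧ max 0 ((ρ : ℝ) - G.timeElapse h) ≤ m.delay ∧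
      ∀ Δ' ∈ Set.Icc m.delay (m.delay + ε), ⟨Δ', m.act⟩ ∈ G.Γ₁ h.last)}

/-- `ε`-jitter `ρ`-response bounded-robust strategies of player 1. -/
structure JRStrategy (ε ρ : ℝ≥0) where
  move : Prefix S A₁ A₂ → Move A₁
  avail : ∀ (r : G.Run) k, move (r.pre k) ∈ G.jrMoves ε ρ (r.pre k)

/-- The exact moves that a proposed move may turn into under a jitter of at most `ε`. -/
def _root_.TimedGames.Move.jitter {A : Type*} (ε : ℝ≥0) (m : Move A) : Set (Move A) :=
  {m' | (m.act = none ∧ m' = m) ∨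
    (m.act ≠ none ∧ ∃ e ∈ Set.Icc 0 ε, m' = ⟨m.delay + e, m.act⟩)}

variable {G}

/-- The possible outcomes from `s` in the jitter-response semantics. -/
def jrOutcomes {ε ρ : ℝ≥0} (s : S) (π₁ : G.JRStrategy ε ρ) (π₂ : G.Strategy₂) : Set G.Run :=
  {r | r.state 0 = s ∧ (∀ k, r.move₁ k ∈ (π₁.move (r.pre k)).jitter ε) ∧
    ∀ k, r.move₂ k = π₂.move (r.pre k)}

def JRStrategy.Receptive {ε ρ : ℝ≥0} (π₁ : G.JRStrategy ε ρ) : Prop :=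
  ∀ (π₂ : G.Strategy₂) (s : S), jrOutcomes s π₁ π₂ ⊆ G.timeDiv ∪ G.blameless₁

variable (G)

/-- The bounded-robust winning set of player 1 with jitter `ε` and response time `ρ`. -/
def jrWinTimeDiv (ε ρ : ℝ≥0) (Φ : Set G.Run) : Set S :=
  {s | ∃ π₁ : G.JRStrategy ε ρ, π₁.Receptive ∧
    ∀ π₂ : G.Strategy₂, π₂.Receptive → jrOutcomes s π₁ π₂ ⊆ Φ}

end TimedGame

/-! ### Timed automaton games -/

/-- Clock constraints `x ≤ d`, `d ≤ x`, `¬ θ`, `θ₁ ∧ θ₂`. -/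
inductive ClockConstraint (C : Type*) where
  | le (x : C) (d : ℕ) : ClockConstraint C
  | ge (d : ℕ) (x : C) : ClockConstraint C
  | not (θ : ClockConstraint C) : ClockConstraint C
  | and (θ₁ θ₂ : ClockConstraint C) : ClockConstraint C

/-- `κ` satisfies the clock constraint. -/
def ClockConstraint.Sat {C : Type*} : ClockConstraint C → (C → ℝ≥0) → Prop
  | .le x d, κ => κ x ≤ d
  | .ge d x, κ => d ≤ κ x
  | .not θ, κ => ¬ θ.Sat κ
  | .and θ₁ θ₂, κ => θ₁.Sat κ ∧ θ₂.Sat κ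

/-- The clock valuation `κ + Δ`. -/
def shift {C : Type*} (κ : C → ℝ≥0) (Δ : ℝ≥0) : C → ℝ≥0 := fun x => κ x + Δ

open Classical in
/-- The clock valuation `κ[lam := 0]`. -/
noncomputable def resetTo {C : Type*} (κ : C → ℝ≥0) (lam : Set C) : C → ℝ≥0 :=
  fun x => if x ∈ lam then 0 else κ x

/-- Edges `⟨l, a, θ, l', lam⟩`. -/
structure Edge (L C A₁ A₂ : Type*) where
  src : L
  act : A₁ ⊕ A₂
  guard : ClockConstraint C
  tgt : L
  reset : Set C

/-- Timed automaton games with locations `L` and clocks `C` (both are finite wherever timed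
automaton games are considered). -/
structure TimedAutomaton (L C A₁ A₂ : Type*) where
  E : Set (Edge L C A₁ A₂)
  inv : L → ClockConstraint C
  unique : ∀ e ∈ E, ∀ e' ∈ E, e.src = e'.src → e.act = e'.act → e = e'

namespace TimedAutomaton

variable {L C A₁ A₂ : Type*} (T : TimedAutomaton L C A₁ A₂)

/-- States: a location with a clock valuation satisfying its invariant. -/
@[ext]
structure State where
  loc : L
  val : C → ℝ≥0
  sat : (T.inv loc).Sat val

/-- After waiting `Δ` in `s`, the edge `e` with label `a` can be taken. -/
def Enabled (s : T.State) (Δ : ℝ≥0) (a : A₁ ⊕ A₂) (e : Edge L C A₁ A₂) : Prop :=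
  e ∈ T.E ∧ e.src = s.loc ∧ e.act = a ∧ e.guard.Sat (shift s.val Δ) ∧
    (T.inv e.tgt).Sat (resetTo (shift s.val Δ) e.reset)

/-- The invariant holds while waiting `Δ`, and after that an edge with the given label (if any)
can be taken. -/
def Avail (s : T.State) (Δ : ℝ≥0) (o : Option (A₁ ⊕ A₂)) : Prop :=
  (∀ Δ' ≤ Δ, (T.inv s.loc).Sat (shift s.val Δ')) ∧
    ∀ a, o = some a → ∃ e, T.Enabled s Δ a e

open Classical in
/-- The successor of `s` after waiting `Δ` and then taking the edge with the given label (if any).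
Where no such successor exists, the value is `s`. -/
noncomputable def succ (s : T.State) (Δ : ℝ≥0) : Option (A₁ ⊕ A₂) → T.State
  | none => if h : (T.inv s.loc).Sat (shift s.val Δ) then ⟨s.loc, shift s.val Δ, h⟩ else s
  | some a =>
      if h : ∃ e, T.Enabled s Δ a e then
        ⟨h.choose.tgt, resetTo (shift s.val Δ) h.choose.reset, h.choose_spec.2.2.2.2⟩
      else s

theorem shift_shift {C : Type*} (κ : C → ℝ≥0) (a b : ℝ≥0) :
    shift (shift κ a) b = shift κ (a + b) := by
  funext x; simp [shift, add_assoc]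

theorem succ_none {s : T.State} {Δ : ℝ≥0} (h : (T.inv s.loc).Sat (shift s.val Δ)) :
    T.succ s Δ none = ⟨s.loc, shift s.val Δ, h⟩ := by
  simp [succ, h]

theorem succ_some {s : T.State} {Δ : ℝ≥0} {a : A₁ ⊕ A₂} {e : Edge L C A₁ A₂}
    (h : T.Enabled s Δ a e) :
    T.succ s Δ (some a) = ⟨e.tgt, resetTo (shift s.val Δ) e.reset, h.2.2.2.2⟩ := by
  have hex : ∃ e, T.Enabled s Δ a e := ⟨e, h⟩
  have he : hex.choose = e :=
    T.unique _ hex.choose_spec.1 _ h.1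
      (hex.choose_spec.2.1.trans h.2.1.symm) (hex.choose_spec.2.2.1.trans h.2.2.1.symm)
  simp only [succ, hex, dif_pos]
  ext1 <;> simp [he]

theorem enabled_succ {s : T.State} {Δ Δ' : ℝ≥0} (hle : Δ' ≤ Δ) {a : A₁ ⊕ A₂}
    {e : Edge L C A₁ A₂} (h : (T.inv s.loc).Sat (shift s.val Δ')) :
    T.Enabled (T.succ s Δ' none) (Δ - Δ') a e ↔ T.Enabled s Δ a e := by
  rw [T.succ_none h]
  simp [Enabled, shift_shift, add_tsub_cancel_of_le hle]

theorem avail_split (s : T.State) (Δ Δ' : ℝ≥0) (o : Option (A₁ ⊕ A₂)) (hle : Δ' ≤ Δ) :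
    T.Avail s Δ o ↔ T.Avail s Δ' none ∧ T.Avail (T.succ s Δ' none) (Δ - Δ') o := by
  constructor
  · rintro ⟨h1, h2⟩
    refine ⟨⟨fun d hd => h1 d (hd.trans hle), by simp⟩, fun d hd => ?_, fun a ha => ?_⟩
    · rw [T.succ_none (h1 _ hle)]
      simp only [shift_shift]
      exact h1 _ (by rw [← add_tsub_cancel_of_le hle]; gcongr)
    · obtain ⟨e, he⟩ := h2 a ha
      exact ⟨e, (T.enabled_succ hle (h1 _ hle)).2 he⟩
  · rintro ⟨⟨h1, -⟩, h3, h4⟩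
    refine ⟨fun d hd => ?_, fun a ha => ?_⟩
    · rcases le_total d Δ' with h | h
      · exact h1 d h
      · have := h3 (d - Δ') (tsub_le_tsub_right hd _)
        rw [T.succ_none (h1 _ le_rfl)] at this
        simpa [shift_shift, add_tsub_cancel_of_le h] using this
    · obtain ⟨e, he⟩ := h4 a ha
      exact ⟨e, (T.enabled_succ hle (h1 _ le_rfl)).1 he⟩

theorem succ_comp (s : T.State) (Δ Δ' : ℝ≥0) (o : Option (A₁ ⊕ A₂)) (hle : Δ' ≤ Δ)
    (h : T.Avail s Δ o) : T.succ (T.succ s Δ' none) (Δ - Δ') o = T.succ s Δ o := by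
  have hs := h.1 _ hle
  cases o with
  | none =>
    have h' := h.1 _ le_rfl
    rw [T.succ_none h', T.succ_none (s := T.succ s Δ' none)] <;>
      simp [T.succ_none hs, shift_shift, add_tsub_cancel_of_le hle, h']
  | some a =>
    obtain ⟨e, he⟩ := h.2 a rfl
    rw [T.succ_some he, T.succ_some ((T.enabled_succ hle hs).2 he)]
    simp [T.succ_none hs, shift_shift, add_tsub_cancel_of_le hle]

theorem avail_stutter (s : T.State) : T.Avail s 0 none :=
  ⟨fun d hd => by
    have : d = 0 := le_antisymm hd bot_le
    subst this
    have h0 : shift s.val 0 = s.val := by funext x; simp [shift]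
    rw [h0]; exact s.sat, by simp⟩

/-- The timed game structure of a timed automaton game. -/
noncomputable def game : TimedGame T.State A₁ A₂ where
  Γ₁ s := {m | T.Avail s m.delay (m.act.map Sum.inl)}
  Γ₂ s := {m | T.Avail s m.delay (m.act.map Sum.inr)}
  δ₁ s m := T.succ s m.delay (m.act.map Sum.inl)
  δ₂ s m := T.succ s m.delay (m.act.map Sum.inr)
  stutter₁ s := T.avail_stutter s
  stutter₂ s := T.avail_stutter s
  split₁ s Δ Δ' a h := T.avail_split s Δ Δ' (a.map Sum.inl) h
  split₂ s Δ Δ' a h := T.avail_split s Δ Δ' (a.map Sum.inr) h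
  comp₁ s Δ Δ' a h hm := T.succ_comp s Δ Δ' (a.map Sum.inl) h hm
  comp₂ s Δ Δ' a h hm := T.succ_comp s Δ Δ' (a.map Sum.inr) h hm

end TimedAutomaton

/-! ### The example automaton with the cycle `l⁰, l¹`

Locations are `0, 1, 2, 3 : Fin 4`; clock `0 : Fin 2` is `x` and clock `1` is `y`. The actions
`a₁¹, …, a₁⁴` of player 1 are `0, …, 3 : Fin 4`; the actions `a₂¹, a₂², a₂³` of player 2 are
`0, 1, 2 : Fin 3`. -/

namespace Example

/-- The constraint `true`, as `0 ≤ x`. -/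
def tt : ClockConstraint (Fin 2) := .ge 0 0
/-- The constraint `x ≤ 1`. -/
def xLe1 : ClockConstraint (Fin 2) := .le 0 1
/-- The constraint `x > 1`. -/
def xGt1 : ClockConstraint (Fin 2) := .not (.le 0 1)
/-- The constraint `y > 1`. -/
def yGt1 : ClockConstraint (Fin 2) := .not (.le 1 1)

/-- The edges: the cycle `l⁰, l¹`, the cycle `l⁰, l²`, and the edges of player 2 to `l³`. -/
def edges : Set (Edge (Fin 4) (Fin 2) (Fin 4) (Fin 3)) :=
  { ⟨0, .inl 0, xLe1, 1, {0}⟩,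
    ⟨1, .inl 1, yGt1, 0, {1}⟩,
    ⟨0, .inl 2, tt, 2, ∅⟩,
    ⟨2, .inl 3, tt, 0, ∅⟩,
    ⟨0, .inr 0, xGt1, 3, ∅⟩,
    ⟨1, .inr 1, xGt1, 3, ∅⟩,
    ⟨2, .inr 2, xGt1, 3, ∅⟩ }

/-- The example automaton; all invariants are `true`. -/
def automaton : TimedAutomaton (Fin 4) (Fin 2) (Fin 4) (Fin 3) where
  E := edges
  inv _ := tt
  unique := by
    intro e he e' he' h1 h2
    simp only [edges, Set.mem_insert_iff, Set.mem_singleton_iff] at he he'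
    rcases he with rfl | rfl | rfl | rfl | rfl | rfl | rfl <;>
      rcases he' with rfl | rfl | rfl | rfl | rfl | rfl | rfl <;>
      first | rfl | simp at h1 h2

/-- The state with location `l⁰` and `x = y = c`. -/
def init (c : ℝ≥0) : automaton.State :=
  ⟨0, fun _ => c, by simp [automaton, tt, ClockConstraint.Sat]⟩

/-- The location parity index function: `1` at `l³` and `0` elsewhere. -/
def index (s : automaton.State) : ℕ := if s.loc = 3 then 1 else 0

/-- The objective `□ ¬ l³`: the location `l³` is never visited. -/
def avoid : Set automaton.game.Run := {r | ∀ k, (r.state k).loc ≠ 3}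

end Example

end TimedGames

/-!
Both inclusions come from restricting the outcomes: a bounded-robust strategy is the limit-robust
strategy with the intervals `[Δ, Δ + ε]` and has the same outcomes (`jrWinTimeDiv_subset`), and an
exact strategy that always realizes a limit-robust one at the right end of its intervals has fewer
outcomes (`robWinTimeDiv_subset`). Receptiveness and winning are universal statements about
outcomes, so they are inherited.

In the example, player 2 has the receptive strategy `punish`: go to `l³` at once if `x > 1`, and
propose to wait for two time units otherwise. Against it, a player 1 whose proper moves all have
positive delays can avoid `l³` only by making a proper move in every step and keeping `x ≤ 1`
(`step_of_avoid`). Negative results follow by realizing every move of player 1 as late as possible.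
At `x = y = 1`, a limit-robust proper move lets `x` exceed `1` (`init_one_not_mem`). With jitter
`ε`, each cycle through `l⁰` and `l¹` raises the difference `x - y` on the return to `l⁰` by at
least `ε`, and each step within a cycle lets time `ε` pass; `potential` combines both into one
bounded quantity that would have to grow by `ε` in every step (`not_mem_jrWinTimeDiv`).

On the positive side, player 1 cycles between `l⁰` and `l¹` as long as `x < 1`. The margin `1 - x`
shrinks but stays positive, so intervals are available forever and player 2 never gets to use an
edge. Each reset of `y` requires `y > 1`, so infinitely many cycles take infinite time; outside the
region where the cycle is possible, player 1 only waits and is blameless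
(`timeDiv_or_blameless_of_cycleMoves`). An exact strategy can also start the cycle at `x = y = 1`, by
taking the edge to `l¹` without delay.
-/

namespace TimedGames

open Filter

/-! ### Existence of runs and of outcomes -/

namespace TimedGame

variable {S A₁ A₂ : Type*} {G : TimedGame S A₁ A₂}

theorem Run.last_pre (r : G.Run) (k : ℕ) : (r.pre k).last = r.state k := by
  cases k <;> rfl

/-- The successor in which a tie between two proper moves is resolved in favour of player 2. -/
noncomputable def tieBreak (G : TimedGame S A₁ A₂) (s : S) (m₁ : Move A₁) (m₂ : Move A₂) : S :=
  open Classical in if m₁.act = none ∨ m₂.delay ≤ m₁.delay then G.δ₂ s m₂ else G.δ₁ s m₁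

theorem tieBreak_mem_jd (s : S) (m₁ : Move A₁) (m₂ : Move A₂) :
    G.tieBreak s m₁ m₂ ∈ G.jd s m₁ m₂ := by
  unfold tieBreak
  split_ifs with h
  · exact Or.inr ⟨h, rfl⟩
  · rw [not_or, not_le] at h
    exact Or.inl ⟨h.1, h.2.le, rfl⟩

theorem stutter_mem_jd (s : S) : G.δ₂ s ⟨0, none⟩ ∈ G.jd s ⟨0, none⟩ ⟨0, none⟩ :=
  Or.inr ⟨Or.inl rfl, rfl⟩

/-- The run from `s` in which both players always propose `⟨0, ⊥⟩`. -/
def stutterRun (G : TimedGame S A₁ A₂) (s : S) : G.Run where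
  state k := (fun t => G.δ₂ t ⟨0, none⟩)^[k] s
  move₁ _ := ⟨0, none⟩
  move₂ _ := ⟨0, none⟩
  avail₁ _ := G.stutter₁ _
  avail₂ _ := G.stutter₂ _
  step k := by
    rw [Function.iterate_succ_apply']
    exact stutter_mem_jd _

/-- A run prefix followed by a legal step is again a run prefix: after the step, both players
stutter forever. -/
theorem Run.exists_pre_succ (r : G.Run) (k : ℕ) {m₁ : Move A₁} {m₂ : Move A₂} {s : S}
    (h₁ : m₁ ∈ G.Γ₁ (r.state k)) (h₂ : m₂ ∈ G.Γ₂ (r.state k)) (hs : s ∈ G.jd (r.state k) m₁ m₂) :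
    ∃ r' : G.Run, r'.pre (k + 1) = .snoc (r.pre k) m₁ m₂ s := by
  let r' : G.Run :=
    { state := fun j => if j ≤ k then r.state j else (G.stutterRun s).state (j - (k + 1))
      move₁ := fun j => if j < k then r.move₁ j else if j = k then m₁ else ⟨0, none⟩
      move₂ := fun j => if j < k then r.move₂ j else if j = k then m₂ else ⟨0, none⟩
      avail₁ := by
        intro j
        rcases lt_trichotomy j k with h | rfl | h
        · simpa [h, h.le] using r.avail₁ j
        · simpa using h₁
        · simpa [h.not_gt, h.ne', h.not_ge] using G.stutter₁ _
      avail₂ := by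
        intro j
        rcases lt_trichotomy j k with h | rfl | h
        · simpa [h, h.le] using r.avail₂ j
        · simpa using h₂
        · simpa [h.not_gt, h.ne', h.not_ge] using G.stutter₂ _
      step := by
        intro j
        rcases lt_trichotomy j k with h | rfl | h
        · simpa [h, h.le, Nat.succ_le_iff.2 h] using r.step j
        · simpa [stutterRun] using hs
        · have h' : ¬ j + 1 ≤ k := by omega
          have e : j + 1 - (k + 1) = j - (k + 1) + 1 := by omega
          simpa [h.not_gt, h.ne', h.not_ge, h', e, stutterRun] using
            (G.stutterRun s).step (j - (k + 1)) }
  have hpre : ∀ j ≤ k, r'.pre j = r.pre j := by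
    intro j
    induction j with
    | zero => intro _; simp [Run.pre, r']
    | succ j ih =>
      intro hj
      simp [Run.pre, ih (by omega), r', hj, show j < k from hj]
  refine ⟨r', ?_⟩
  simp only [Run.pre, hpre k le_rfl]
  simp [r', stutterRun]

/-- Strategies are constrained on run prefixes only, so the outcome is built together with the
proof that each of its finite parts is a prefix of some run. -/
theorem outcomes_nonempty (s : S) (π₁ : G.Strategy₁) (π₂ : G.Strategy₂) :
    (outcomes s π₁ π₂).Nonempty := by
  let H : ℕ → Prefix S A₁ A₂ := fun n => Nat.rec (.start s) (fun _ h =>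
    .snoc h (π₁.move h) (π₂.move h) (G.tieBreak h.last (π₁.move h) (π₂.move h))) n
  have hH : ∀ n, H (n + 1) = .snoc (H n) (π₁.move (H n)) (π₂.move (H n))
      (G.tieBreak (H n).last (π₁.move (H n)) (π₂.move (H n))) := fun n => rfl
  have hrun : ∀ n, ∃ r : G.Run, r.pre n = H n := by
    intro n
    induction n with
    | zero => exact ⟨G.stutterRun s, rfl⟩
    | succ n ih =>
      obtain ⟨r, hr⟩ := ih
      obtain ⟨r', hr'⟩ := r.exists_pre_succ n (π₁.avail r n) (π₂.avail r n)
        (tieBreak_mem_jd (r.state n) _ _)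
      refine ⟨r', ?_⟩
      rw [hr', hH, ← hr, r.last_pre]
  have h₁ : ∀ n, π₁.move (H n) ∈ G.Γ₁ (H n).last := by
    intro n
    obtain ⟨r, hr⟩ := hrun n
    rw [← hr, r.last_pre]
    exact π₁.avail r n
  have h₂ : ∀ n, π₂.move (H n) ∈ G.Γ₂ (H n).last := by
    intro n
    obtain ⟨r, hr⟩ := hrun n
    rw [← hr, r.last_pre]
    exact π₂.avail r n
  let r : G.Run := ⟨fun n => (H n).last, fun n => π₁.move (H n), fun n => π₂.move (H n), h₁, h₂,
    fun n => tieBreak_mem_jd _ _ _⟩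
  have hr : ∀ n, r.pre n = H n := by
    intro n
    induction n with
    | zero => rfl
    | succ n ih => simp only [Run.pre, ih, hH]; rfl
  exact ⟨r, rfl, fun n => by rw [hr], fun n => by rw [hr]⟩

/-! ### Criteria for time divergence -/

theorem Run.time_succ (r : G.Run) (k : ℕ) :
    r.time (k + 1) = r.time k + elapsed (r.move₁ k) (r.move₂ k) :=
  Finset.sum_range_succ _ _

open Classical in
/-- Time diverges if, up to a bounded error, it grows at least linearly in the number of
occurrences of an event that occurs infinitely often. -/
theorem Run.mem_timeDiv_of_count (r : G.Run) {p : ℕ → Prop} (hp : ∃ᶠ k in atTop, p k)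
    {c : ℝ} (hc : 0 < c) (C : ℝ) (h : ∀ k, c * Nat.count p k ≤ r.time k + C) :
    r ∈ G.timeDiv := by
  have hmono : Monotone r.time :=
    monotone_nat_of_le_succ fun k => by rw [r.time_succ]; exact le_self_add
  refine tendsto_atTop_atTop_of_monotone hmono fun b => ?_
  obtain ⟨n, hn⟩ := exists_nat_ge ((b + C) / c)
  obtain ⟨k, hk⟩ := Nat.surjective_count_of_infinite_setOfPred
    (Nat.frequently_atTop_iff_infinite.1 hp) n
  refine ⟨k, ?_⟩
  have := h k
  rw [hk] at this
  rw [div_le_iff₀ hc] at hn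
  rw [← NNReal.coe_le_coe]
  linarith

theorem Run.mem_timeDiv_of_frequently (r : G.Run) {c : ℝ≥0} (hc : 0 < c)
    (h : ∃ᶠ k in atTop, c ≤ elapsed (r.move₁ k) (r.move₂ k)) : r ∈ G.timeDiv := by
  classical
  refine r.mem_timeDiv_of_count h (c := c) (by exact_mod_cast hc) 0 fun k => ?_
  induction k with
  | zero => simp
  | succ k ih =>
    rw [Nat.count_succ, r.time_succ]
    split_ifs with hk
    · have : (c : ℝ) ≤ elapsed (r.move₁ k) (r.move₂ k) := by exact_mod_cast hk
      push_cast
      linarith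
    · have := (elapsed (r.move₁ k) (r.move₂ k)).2
      push_cast
      linarith

/-! ### Passing between the three kinds of strategies -/

/-- A proper move with jitter `ε` is the limit-robust move on the interval `[Δ, Δ + ε]`. -/
def _root_.TimedGames.Move.toRobMove {A : Type*} (ε : ℝ≥0) : Move A → RobMove A
  | ⟨Δ, none⟩ => .wait Δ
  | ⟨Δ, some a⟩ => .interval Δ (Δ + ε) a

theorem _root_.TimedGames.Move.realizations_toRobMove {A : Type*} (ε : ℝ≥0) (m : Move A) :
    (m.toRobMove ε).realizations = m.jitter ε := by
  obtain ⟨Δ, _ | a⟩ := m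
  · simp [Move.toRobMove, RobMove.realizations, Move.jitter]
  · ext m'
    simp only [Move.toRobMove, RobMove.realizations, Move.jitter, Set.mem_ofPred_eq]
    constructor
    · rintro ⟨d, ⟨h1, h2⟩, rfl⟩
      refine Or.inr ⟨by simp, d - Δ, ⟨bot_le, ?_⟩, ?_⟩
      · rwa [tsub_le_iff_left]
      · rw [add_tsub_cancel_of_le h1]
    · rintro (⟨h, -⟩ | ⟨-, e, he, rfl⟩)
      · simp at h
      · exact ⟨Δ + e, ⟨le_self_add, by gcongr; exact he.2⟩, rfl⟩

theorem jitter_subset_of_mem_jrMoves {ε ρ : ℝ≥0} {h : Prefix S A₁ A₂} {m : Move A₁}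
    (hm : m ∈ G.jrMoves ε ρ h) : m.jitter ε ⊆ G.Γ₁ h.last := by
  rintro m' (⟨h1, rfl⟩ | ⟨h1, e, he, rfl⟩)
  · rcases hm with hm | hm
    · exact hm.2
    · exact absurd h1 hm.1
  · rcases hm with hm | hm
    · exact absurd hm.1 h1
    · exact hm.2.2 _ ⟨le_self_add, by gcongr; exact he.2⟩

/-- The limit-robust strategy whose outcomes are those of the bounded-robust strategy `π`. -/
def JRStrategy.toRob {ε ρ : ℝ≥0} (π : G.JRStrategy ε ρ) (hε : 0 < ε) : G.RobStrategy where
  move h := (π.move h).toRobMove ε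
  avail r k := by
    refine ⟨?_, ?_⟩
    · generalize π.move (r.pre k) = m
      obtain ⟨Δ, _ | a⟩ := m
      · trivial
      · exact lt_add_of_pos_right Δ hε
    · rw [Move.realizations_toRobMove, ← r.last_pre]
      exact jitter_subset_of_mem_jrMoves (π.avail r k)

theorem JRStrategy.robOutcomes_toRob {ε ρ : ℝ≥0} (π : G.JRStrategy ε ρ) (hε : 0 < ε) (s : S)
    (π₂ : G.Strategy₂) : robOutcomes s (π.toRob hε) π₂ = jrOutcomes s π π₂ := by
  simp only [robOutcomes, jrOutcomes, JRStrategy.toRob, Move.realizations_toRobMove]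

theorem jrWinTimeDiv_subset {ε : ℝ≥0} (ρ : ℝ≥0) (hε : 0 < ε) (Φ : Set G.Run) :
    G.jrWinTimeDiv ε ρ Φ ⊆ G.robWinTimeDiv Φ := by
  rintro s ⟨π, hrec, hwin⟩
  exact ⟨π.toRob hε, fun π₂ s => (π.robOutcomes_toRob hε s π₂).trans_subset (hrec π₂ s),
    fun π₂ h₂ => (π.robOutcomes_toRob hε s π₂).trans_subset (hwin π₂ h₂)⟩

/-- The exact move with the largest possible delay. -/
def _root_.TimedGames.RobMove.latest {A : Type*} : RobMove A → Move A
  | .wait Δ => ⟨Δ, none⟩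
  | .interval _ β a => ⟨β, some a⟩

theorem _root_.TimedGames.RobMove.latest_mem {A : Type*} {m : RobMove A} (hm : m.NonDegenerate) :
    m.latest ∈ m.realizations := by
  cases m with
  | wait Δ => rfl
  | interval α β a => exact ⟨β, ⟨le_of_lt hm, le_rfl⟩, rfl⟩

/-- The exact strategy that always realizes a limit-robust strategy as late as possible. -/
def RobStrategy.latest (π : G.RobStrategy) : G.Strategy₁ where
  move h := (π.move h).latest
  avail r k := (π.avail r k).2 (RobMove.latest_mem (π.avail r k).1)

theorem RobStrategy.outcomes_latest_subset (π : G.RobStrategy) (s : S) (π₂ : G.Strategy₂) :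
    outcomes s π.latest π₂ ⊆ robOutcomes s π π₂ := by
  rintro r ⟨h0, h1, h2⟩
  refine ⟨h0, fun k => ?_, h2⟩
  rw [h1]
  exact RobMove.latest_mem (π.avail r k).1

theorem robWinTimeDiv_subset (Φ : Set G.Run) : G.robWinTimeDiv Φ ⊆ G.winTimeDiv Φ := by
  rintro s ⟨π, hrec, hwin⟩
  exact ⟨π.latest, fun π₂ s => (π.outcomes_latest_subset s π₂).trans (hrec π₂ s),
    fun π₂ h₂ => (π.outcomes_latest_subset s π₂).trans (hwin π₂ h₂)⟩

end TimedGame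

end TimedGames

namespace TimedGames.Example

open Filter TimedGame

/-! ### Steps of the example automaton -/

theorem sat_tt (κ : Fin 2 → ℝ≥0) : tt.Sat κ := by simp [tt, ClockConstraint.Sat]

theorem wait_mem₂ (s : automaton.State) (d : ℝ≥0) : ⟨d, none⟩ ∈ automaton.game.Γ₂ s :=
  ⟨fun _ _ => sat_tt _, by simp⟩

theorem toOne_mem {s : automaton.State} {d : ℝ≥0} (hl : s.loc = 0) (hx : s.val 0 + d ≤ 1) :
    ⟨d, some 0⟩ ∈ automaton.game.Γ₁ s := by
  refine ⟨fun _ _ => sat_tt _, ?_⟩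
  rintro a ⟨rfl⟩
  refine ⟨⟨0, .inl 0, xLe1, 1, {0}⟩, by simp [automaton, edges], hl.symm, rfl, ?_, sat_tt _⟩
  simpa [xLe1, ClockConstraint.Sat, shift] using hx

theorem toZero_mem {s : automaton.State} {d : ℝ≥0} (hl : s.loc = 1) (hy : 1 < s.val 1 + d) :
    ⟨d, some 1⟩ ∈ automaton.game.Γ₁ s := by
  refine ⟨fun _ _ => sat_tt _, ?_⟩
  rintro a ⟨rfl⟩
  refine ⟨⟨1, .inl 1, yGt1, 0, {1}⟩, by simp [automaton, edges], hl.symm, rfl, ?_, sat_tt _⟩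
  simpa [yGt1, ClockConstraint.Sat, shift] using hy

/-- The proper steps of player 1, with their guards and their effect on the clocks. -/
theorem step₁ {s : automaton.State} {d : ℝ≥0} {a : Fin 4}
    (h : ⟨d, some a⟩ ∈ automaton.game.Γ₁ s) {t : automaton.State}
    (ht : t = automaton.game.δ₁ s ⟨d, some a⟩) :
    (a = 0 ∧ s.loc = 0 ∧ s.val 0 + d ≤ 1 ∧ t.loc = 1 ∧ t.val 0 = 0 ∧ t.val 1 = s.val 1 + d) ∨
    (a = 1 ∧ s.loc = 1 ∧ 1 < s.val 1 + d ∧ t.loc = 0 ∧ t.val 0 = s.val 0 + d ∧ t.val 1 = 0) ∨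
    (a = 2 ∧ s.loc = 0 ∧ t.loc = 2 ∧ t.val 0 = s.val 0 + d ∧ t.val 1 = s.val 1 + d) ∨
    (a = 3 ∧ s.loc = 2 ∧ t.loc = 0 ∧ t.val 0 = s.val 0 + d ∧ t.val 1 = s.val 1 + d) := by
  obtain ⟨e, he⟩ := h.2 (.inl a) rfl
  obtain ⟨htl, htv⟩ : t.loc = e.tgt ∧ t.val = resetTo (shift s.val d) e.reset := by
    rw [ht.trans (automaton.succ_some he)]
    exact ⟨rfl, rfl⟩
  obtain ⟨hE, hsrc, hact, hg, -⟩ := he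
  clear ht h
  simp only [automaton, edges, Set.mem_insert_iff, Set.mem_singleton_iff] at hE
  rcases hE with rfl | rfl | rfl | rfl | rfl | rfl | rfl <;>
    simp_all [resetTo, shift, xLe1, yGt1, ClockConstraint.Sat, eq_comm]

/-- The steps of player 2: waiting, or, when `x > 1`, going to `l³`, which cannot be left. -/
theorem step₂ {s : automaton.State} {m : Move (Fin 3)} (h : m ∈ automaton.game.Γ₂ s)
    {t : automaton.State} (ht : t = automaton.game.δ₂ s m) :
    (m.act = none ∧ t.loc = s.loc ∧ ∀ c, t.val c = s.val c + m.delay) ∨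
    (m.act ≠ none ∧ s.loc ≠ 3 ∧ 1 < s.val 0 + m.delay ∧ t.loc = 3) := by
  obtain ⟨d, _ | a⟩ := m
  · have hst : t = ⟨s.loc, shift s.val d, sat_tt _⟩ := ht.trans (automaton.succ_none (sat_tt _))
    simp [hst, shift]
  · obtain ⟨e, he⟩ := h.2 (.inr a) rfl
    have htl : t.loc = e.tgt := by rw [ht.trans (automaton.succ_some he)]
    obtain ⟨hE, hsrc, hact, hg, -⟩ := he
    clear ht h
    simp only [automaton, edges, Set.mem_insert_iff, Set.mem_singleton_iff] at hE
    rcases hE with rfl | rfl | rfl | rfl | rfl | rfl | rfl <;>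
      simp_all [xGt1, ClockConstraint.Sat, shift, ← hsrc]

theorem loc_eq_three_of_le (r : automaton.game.Run) {j k : ℕ} (hjk : j ≤ k)
    (hj : (r.state j).loc = 3) : (r.state k).loc = 3 := by
  induction k, hjk using Nat.le_induction with
  | base => exact hj
  | succ k _ ih =>
    rcases r.step k with ⟨hne, -, ht⟩ | ⟨-, ht⟩
    · obtain ⟨a, ha⟩ := Option.ne_none_iff_exists'.1 hne
      have hav := r.avail₁ k
      rw [show r.move₁ k = ⟨(r.move₁ k).delay, some a⟩ by rw [← ha]] at hav ht
      have := step₁ hav ht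
      simp [ih] at this
    · rcases step₂ (r.avail₂ k) ht with h | h
      · rw [h.2.1, ih]
      · exact h.2.2.2

/-- Since `l³` cannot be left, the index is eventually constant along every run. -/
theorem avoid_eq_parity : avoid = automaton.game.parity index := by
  ext r
  have key : ∀ p, (∀ᶠ k in atTop, index (r.state k) = p) →
      sSup {q | ∃ᶠ k in atTop, index (r.state k) = q} = p := by
    intro p hp
    have : {q | ∃ᶠ k in atTop, index (r.state k) = q} = {p} := by
      ext q
      simp only [Set.mem_ofPred_eq, Set.mem_singleton_iff]
      constructor
      · intro hq
        obtain ⟨k, h1, h2⟩ := (hq.and_eventually hp).exists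
        exact h1.symm.trans h2
      · rintro rfl
        exact hp.frequently
    rw [this, csSup_singleton]
  show (∀ k, (r.state k).loc ≠ 3) ↔ Even (sSup {q | ∃ᶠ k in atTop, index (r.state k) = q})
  constructor
  · intro h
    rw [key 0 (.of_forall fun k => if_neg (h k))]
    exact Even.zero
  · intro h j hj
    rw [key 1 (eventually_atTop.2 ⟨j, fun k hk => if_pos (loc_eq_three_of_le r hk hj)⟩)] at h
    exact Nat.not_even_one h

/-! ### A receptive strategy of player 2 that punishes `x > 1` -/

/-- The edge of player 2 from each location other than `l³`; the value at `l³` is irrelevant. -/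
def exitAction : Fin 4 → Fin 3 := ![0, 1, 2, 0]

open Classical in
/-- Player 2 goes to `l³` at once if `x > 1`, and proposes to wait for two time units otherwise. -/
noncomputable def punishMove (s : automaton.State) : Move (Fin 3) :=
  if s.loc ≠ 3 ∧ 1 < s.val 0 then ⟨0, some (exitAction s.loc)⟩ else ⟨2, none⟩

theorem punishMove_mem (s : automaton.State) : punishMove s ∈ automaton.game.Γ₂ s := by
  unfold punishMove
  split_ifs with h
  · refine ⟨fun _ _ => sat_tt _, ?_⟩
    rintro a ⟨rfl⟩
    obtain ⟨hl, hx⟩ := h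
    have hg : xGt1.Sat (shift s.val 0) := by simpa [xGt1, ClockConstraint.Sat, shift] using hx
    refine ⟨⟨s.loc, .inr (exitAction s.loc), xGt1, 3, ∅⟩, ?_, rfl, rfl, hg, sat_tt _⟩
    generalize s.loc = l at hl ⊢
    fin_cases l <;> simp_all [automaton, edges, exitAction]
  · exact wait_mem₂ _ _

/-- The strategy of player 2 that makes the move `punishMove`. -/
noncomputable def punish : automaton.game.Strategy₂ where
  move h := punishMove h.last
  avail r k := by rw [r.last_pre]; exact punishMove_mem _

theorem punish_receptive : punish.Receptive := by
  rintro π₁ s r ⟨-, -, h2⟩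
  by_cases hb : r ∈ automaton.game.blameless₂
  · exact Or.inr hb
  left
  have hfreq : ∃ᶠ k in atTop, automaton.game.Blame₂ (r.state k) (r.move₁ k) (r.move₂ k)
      (r.state (k + 1)) := by
    intro hne
    obtain ⟨k, hk⟩ := eventually_atTop.1 hne
    exact hb ⟨k, hk⟩
  have hm : ∀ k, r.move₂ k = punishMove (r.state k) := fun k => by
    rw [h2, ← r.last_pre]; rfl
  -- The move to `l³` is made at most once; all other moves of player 2 take two time units.
  have hev : ∀ᶠ k in atTop, ¬ ((r.state k).loc ≠ 3 ∧ (r.state (k + 1)).loc = 3) := by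
    by_cases h3 : ∃ j, (r.state j).loc = 3
    · obtain ⟨j, hj⟩ := h3
      exact eventually_atTop.2 ⟨j, fun k hk h => h.1 (loc_eq_three_of_le r hk hj)⟩
    · push Not at h3
      exact .of_forall fun k h => h3 _ h.2
  refine r.mem_timeDiv_of_frequently two_pos ((hfreq.and_eventually hev).mono ?_)
  rintro k ⟨⟨hle, hδ⟩, hne⟩
  rw [elapsed, min_eq_right hle]
  rcases step₂ (r.avail₂ k) hδ.symm with h | h
  · have := h.1
    rw [hm] at this ⊢
    unfold punishMove at this ⊢
    split_ifs at this ⊢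
    exact le_rfl
  · exact absurd ⟨h.2.1, h.2.2.2⟩ hne

theorem wellFormed : automaton.game.WellFormed := by
  refine ⟨⟨⟨fun _ => ⟨0, none⟩, fun r k => automaton.game.stutter₁ _⟩, ?_⟩,
    punish, punish_receptive⟩
  -- Pure time moves of player 1 are never blamed on player 1.
  rintro π₂ s r ⟨-, h1, -⟩
  exact Or.inr ⟨0, fun k _ hb => hb.2.2 (by rw [h1])⟩

/-- Against `punish`, a player 1 whose proper moves all have positive delays can avoid `l³` only by
making a proper move in each step and keeping `x ≤ 1`. -/
theorem step_of_avoid {r : automaton.game.Run} (hr : r ∈ avoid)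
    (hm : ∀ k, r.move₂ k = punishMove (r.state k))
    (hpos : ∀ k, (r.move₁ k).act ≠ none → 0 < (r.move₁ k).delay) (k : ℕ) :
    (r.state k).val 0 ≤ 1 ∧ (r.move₁ k).act ≠ none ∧
      r.state (k + 1) = automaton.game.δ₁ (r.state k) (r.move₁ k) := by
  have hx : ∀ k, (r.state k).val 0 ≤ 1 := by
    intro k
    by_contra! hx
    have h2 : r.move₂ k = ⟨0, some (exitAction (r.state k).loc)⟩ := by
      rw [hm, punishMove, if_pos ⟨hr k, hx⟩]
    rcases r.step k with ⟨hne, hle, -⟩ | ⟨-, ht⟩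
    · rw [h2] at hle
      exact absurd (hpos k hne) hle.not_gt
    · rcases step₂ (r.avail₂ k) ht with h | h
      · simp [h2] at h
      · exact hr _ h.2.2.2
  rcases r.step k with ⟨hne, -, ht⟩ | ⟨-, ht⟩
  · exact ⟨hx k, hne, ht⟩
  · rcases step₂ (r.avail₂ k) ht with h | h
    · have h2 : r.move₂ k = ⟨2, none⟩ := by
        rw [hm, punishMove, if_neg fun h => (hx k).not_gt h.2]
      have h1 := hx (k + 1)
      rw [h.2.2 0, h2] at h1
      have : (2 : ℝ≥0) ≤ 1 := le_add_self.trans h1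
      norm_num at this
    · exact absurd h.2.2.2 (hr _)

theorem exists_outcome_latest (s : automaton.State) (π : automaton.game.RobStrategy) :
    ∃ r ∈ robOutcomes s π punish, r.state 0 = s ∧
      (∀ k, r.move₁ k = (π.move (r.pre k)).latest) ∧
      ∀ k, r.move₂ k = punishMove (r.state k) := by
  obtain ⟨r, hr⟩ := outcomes_nonempty s π.latest punish
  refine ⟨r, π.outcomes_latest_subset s punish hr, hr.1, hr.2.1, fun k => ?_⟩
  rw [hr.2.2, ← r.last_pre]
  rfl

theorem latest_delay_pos {A : Type*} {m : RobMove A} (hm : m.NonDegenerate)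
    (h : m.latest.act ≠ none) : 0 < m.latest.delay := by
  cases m with
  | wait Δ => exact absurd rfl h
  | interval α β a => exact bot_le.trans_lt hm

/-! ### Strictness of the two inclusions -/

/-- At `x = y = 1` the edge to `l¹` is enabled for the delay `0` only, so every limit-robust move
lets `x` exceed `1`. -/
theorem init_one_not_mem : init 1 ∉ automaton.game.robWinTimeDiv avoid := by
  rintro ⟨π, -, hwin⟩
  obtain ⟨r, hr, h0, h1, h2⟩ := exists_outcome_latest (init 1) π
  have hpos : ∀ k, (r.move₁ k).act ≠ none → 0 < (r.move₁ k).delay := fun k hk => by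
    rw [h1] at hk ⊢
    exact latest_delay_pos (π.avail r k).1 hk
  have hstep := step_of_avoid (hwin _ punish_receptive hr) h2 hpos
  obtain ⟨-, hne, ht⟩ := hstep 0
  have hx1 := (hstep 1).1
  have hd := hpos 0 hne
  have hav := r.avail₁ 0
  obtain ⟨a, ha⟩ := Option.ne_none_iff_exists'.1 hne
  rw [show r.move₁ 0 = ⟨(r.move₁ 0).delay, some a⟩ by rw [← ha]] at hav ht
  have hx0 : (r.state 0).val 0 = 1 := by rw [h0]; rfl
  have hl0 : (r.state 0).loc = 0 := by rw [h0]; rfl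
  have hgt : 1 < (r.state 0).val 0 + (r.move₁ 0).delay := by
    rw [hx0]; exact lt_add_of_pos_right _ hd
  rcases step₁ hav ht with h | h | h | h
  · exact absurd h.2.2.1 hgt.not_ge
  · simp [hl0] at h
  · rw [show r.state 1 = r.state (0 + 1) from rfl, h.2.2.2.1] at hx1
    exact absurd hx1 hgt.not_ge
  · simp [hl0] at h

/-- A quantity that grows by at least `ε` in every step in which player 1 moves properly with the
maximal jitter `ε` and `x ≤ 1` holds before and after the step. The summand divided by `ε` is at
`l⁰` and `l²` the clock difference `x - y`, and at `l¹` the infimum of the values that this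
difference can have after the return to `l⁰`; no step decreases it. The guard `y > 1` has to hold
before the jitter, so on the edge from `l¹` to `l⁰` the difference grows by `ε`, which outweighs the
change of the other summand by at least `ε - 1`. On the other edges, it is the other summand that
grows by `ε`: either `x` grows, or `x ≤ 1 - ε` is replaced by `1`. -/
noncomputable def potential (ε : ℝ≥0) (s : automaton.State) : ℝ :=
  if s.loc = 1 then 1 + s.val 0 + (1 - s.val 1 + s.val 0) / ε
  else s.val 0 + (s.val 0 - s.val 1) / ε

theorem potential_le {ε : ℝ≥0} (hε : 0 < ε) {s : automaton.State} (hx : s.val 0 ≤ 1) :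
    potential ε s ≤ 2 + 2 / ε := by
  have hε' : (0 : ℝ) < ε := hε
  have hx' : (s.val 0 : ℝ) ≤ 1 := hx
  have hy : (0 : ℝ) ≤ s.val 1 := (s.val 1).2
  unfold potential
  split_ifs
  · have : (1 - s.val 1 + s.val 0 : ℝ) / ε ≤ 2 / ε := by gcongr; linarith
    linarith
  · have : (s.val 0 - s.val 1 : ℝ) / ε ≤ 2 / ε := by gcongr; linarith
    linarith

theorem potential_step {ε d : ℝ≥0} (hε : 0 < ε) {s t : automaton.State} {a : Fin 4}
    (h : ⟨d, some a⟩ ∈ automaton.game.Γ₁ s)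
    (h' : ⟨d + ε, some a⟩ ∈ automaton.game.Γ₁ s)
    (ht : t = automaton.game.δ₁ s ⟨d + ε, some a⟩) (hs : s.val 0 ≤ 1) :
    potential ε s + ε ≤ potential ε t := by
  have hε' : (0 : ℝ) < ε := hε
  have hd : (0 : ℝ) ≤ d := d.2
  have hx : (s.val 0 : ℝ) ≤ 1 := hs
  rcases step₁ h' ht with ⟨-, hl, hg, hl', hx', hy'⟩ | ⟨rfl, hl, -, hl', hx', hy'⟩ |
    ⟨-, hl, hl', hx', hy'⟩ | ⟨-, hl, hl', hx', hy'⟩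
  · rw [← NNReal.coe_le_coe] at hg
    push_cast at hg
    have : (s.val 0 - s.val 1 : ℝ) / ε ≤ (1 - (s.val 1 + (d + ε)) + 0 : ℝ) / ε := by
      gcongr; linarith
    simp only [potential, hl, hl', hx', hy']
    push_cast
    norm_num at this ⊢
    linarith
  · have hg : (1 : ℝ) < s.val 1 + d := by
      have := step₁ h rfl
      simp only [hl] at this
      norm_num at this
      exact_mod_cast this.elim And.left fun h => by simp at h
    have : (1 - s.val 1 + s.val 0 : ℝ) / ε + 1 ≤ (s.val 0 + (d + ε) - 0 : ℝ) / ε := by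
      rw [div_add_one hε'.ne']
      gcongr; linarith
    simp only [potential, hl, hl', hx', hy']
    push_cast
    norm_num at this ⊢
    linarith
  · simp only [potential, hl, hl', hx', hy']
    push_cast
    norm_num
    linarith
  · simp only [potential, hl, hl', hx', hy']
    push_cast
    norm_num
    linarith

theorem not_mem_jrWinTimeDiv {ε : ℝ≥0} (ρ : ℝ≥0) (hε : 0 < ε) (s : automaton.State) :
    s ∉ automaton.game.jrWinTimeDiv ε ρ avoid := by
  rintro ⟨π, -, hwin⟩
  obtain ⟨r, hr, -, h1, h2⟩ := exists_outcome_latest s (π.toRob hε)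
  rw [π.robOutcomes_toRob hε] at hr
  have hpos : ∀ k, (r.move₁ k).act ≠ none → 0 < (r.move₁ k).delay := fun k hk => by
    rw [h1] at hk ⊢
    exact latest_delay_pos ((π.toRob hε).avail r k).1 hk
  have hstep := step_of_avoid (hwin _ punish_receptive hr) h2 hpos
  have hpot : ∀ k, potential ε (r.state k) + ε ≤ potential ε (r.state (k + 1)) := by
    intro k
    obtain ⟨hx, hne, ht⟩ := hstep k
    have hm := π.avail r k
    have hm₁ := h1 k
    simp only [JRStrategy.toRob] at hm₁
    generalize π.move (r.pre k) = m at hm hm₁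
    obtain ⟨d, _ | a⟩ := m
    · rw [hm₁] at hne
      exact absurd rfl hne
    · have hm₁ : r.move₁ k = ⟨d + ε, some a⟩ := hm₁
      have hsub := hm.resolve_left (by simp)
      rw [r.last_pre] at hsub
      exact potential_step hε (hsub.2.2 d ⟨le_rfl, le_self_add⟩)
        (hsub.2.2 (d + ε) ⟨le_self_add, le_rfl⟩) (hm₁ ▸ ht) hx
  have hlin : ∀ k : ℕ, potential ε (r.state 0) + k * ε ≤ potential ε (r.state k) := by
    intro k
    induction k with
    | zero => simp
    | succ k ih =>
      push_cast
      linarith [hpot k]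
  have hε' : (0 : ℝ) < ε := hε
  obtain ⟨n, hn⟩ := exists_nat_gt ((2 + 2 / ε - potential ε (r.state 0)) / ε)
  rw [div_lt_iff₀ hε'] at hn
  linarith [hlin n, potential_le hε (hstep n).1]

/-! ### Cycling between `l⁰` and `l¹` -/

/-- The states from which player 1 cycles between `l⁰` and `l¹`. The parameter `b` tells whether the
boundary case `x = 1` at `l⁰` is included, which an exact strategy can handle if `y > 0`. -/
def Cyclic (b : Prop) (s : automaton.State) : Prop :=
  (s.loc = 0 ∧ (s.val 0 < 1 ∨ b ∧ s.val 0 = 1 ∧ 0 < s.val 1)) ∨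
    (s.loc = 1 ∧ s.val 0 < 1 ∧ s.val 0 < s.val 1)

/-- The available moves of player 1 that keep to the cycle where this is possible, and are pure time
moves elsewhere. Waiting for at most the delay of such a move does not leave `Cyclic b`. -/
def cycleMoves (b : Prop) (s : automaton.State) : Set (Move (Fin 4)) :=
  {m | m ∈ automaton.game.Γ₁ s ∧ (¬ Cyclic b s → m.act = none) ∧
    (Cyclic b s → s.loc = 0 → m.act = some 0 ∧ 0 < s.val 1 + m.delay ∧
      (s.val 0 + m.delay < 1 ∨ b ∧ s.val 0 = 1 ∧ m.delay = 0)) ∧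
    (Cyclic b s → s.loc = 1 → m.act = some 1 ∧ s.val 0 + m.delay < 1)}

theorem cycleMoves_mono {s : automaton.State} (h : Cyclic True s → Cyclic False s) :
    cycleMoves False s ⊆ cycleMoves True s := by
  rintro m ⟨h1, h2, h3, h4⟩
  refine ⟨h1, fun hc => h2 fun hc' => hc ?_, fun hc hl => ?_, fun hc hl => h4 (h hc) hl⟩
  · simp only [Cyclic, false_and, or_false] at hc'
    exact hc'.imp (fun h => ⟨h.1, Or.inl h.2⟩) id
  · exact (h3 (h hc) hl).imp_right (And.imp_right (Or.imp_right fun h => absurd h.1 id))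

theorem one_sub_lt_one_sub {x y : ℝ≥0} (hx : x < 1) (hxy : x < y) : 1 - y < 1 - x := by
  rcases le_total y 1 with hy | hy
  · exact tsub_lt_tsub_left_of_le hy hxy
  · rw [tsub_eq_zero_of_le hy]
    exact tsub_pos_of_lt hx

theorem exists_robMove (s : automaton.State) :
    ∃ m : RobMove (Fin 4), m.NonDegenerate ∧ m.realizations ⊆ cycleMoves False s := by
  by_cases hc : Cyclic False s
  · have hc' := hc
    simp only [Cyclic, false_and, or_false] at hc'
    rcases hc' with ⟨hl, hx⟩ | ⟨hl, hx, hxy⟩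
    · obtain ⟨β, h0, hβ⟩ := exists_between (tsub_pos_of_lt hx)
      obtain ⟨α, hα, hαβ⟩ := exists_between h0
      refine ⟨.interval α β 0, hαβ, ?_⟩
      rintro _ ⟨d, ⟨hd1, hd2⟩, rfl⟩
      have hxd : s.val 0 + d < 1 := lt_tsub_iff_left.1 (hd2.trans_lt hβ)
      exact ⟨toOne_mem hl hxd.le, fun h => absurd hc h,
        fun _ _ => ⟨rfl, (hα.trans_le hd1).trans_le le_add_self, Or.inl hxd⟩,
        fun _ h => by simp [hl] at h⟩
    · obtain ⟨β, h0, hβ⟩ := exists_between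
        (show 1 - s.val 1 < 1 - s.val 0 from one_sub_lt_one_sub hx hxy)
      obtain ⟨α, hα, hαβ⟩ := exists_between h0
      refine ⟨.interval α β 1, hαβ, ?_⟩
      rintro _ ⟨d, ⟨hd1, hd2⟩, rfl⟩
      have hxd : s.val 0 + d < 1 := lt_tsub_iff_left.1 (hd2.trans_lt hβ)
      exact ⟨toZero_mem hl (lt_add_of_tsub_lt_left (hα.trans_le hd1)), fun h => absurd hc h,
        fun _ h => by simp [hl] at h, fun _ _ => ⟨rfl, hxd⟩⟩
  · refine ⟨.wait 0, trivial, ?_⟩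
    rintro _ rfl
    exact ⟨automaton.game.stutter₁ s, fun _ => rfl, fun h => absurd h hc, fun h => absurd h hc⟩

theorem exists_exactMove (s : automaton.State) : (cycleMoves True s).Nonempty := by
  by_cases h : Cyclic True s → Cyclic False s
  · obtain ⟨m, hm, hsub⟩ := exists_robMove s
    exact ⟨_, cycleMoves_mono h (hsub (RobMove.latest_mem hm))⟩
  · push Not at h
    obtain ⟨hc, hc'⟩ := h
    -- This is the boundary case: the edge to `l¹` has to be taken immediately.
    obtain ⟨hl, hx, hy⟩ : s.loc = 0 ∧ s.val 0 = 1 ∧ 0 < s.val 1 := by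
      simp only [Cyclic, true_and, false_and, or_false] at hc hc'
      tauto
    exact ⟨⟨0, some 0⟩, toOne_mem hl (by simp [hx]), fun h => absurd hc h,
      fun _ _ => ⟨rfl, by simpa using hy, Or.inr ⟨trivial, hx, rfl⟩⟩,
      fun _ h => by simp [hl] at h⟩

theorem not_cyclic_succ {b : Prop} {r : automaton.game.Run} {k : ℕ}
    (hm : r.move₁ k ∈ cycleMoves b (r.state k)) (hc : ¬ Cyclic b (r.state k)) :
    ¬ Cyclic b (r.state (k + 1)) := by
  rcases r.step k with ⟨hne, -, -⟩ | ⟨-, ht⟩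
  · exact absurd (hm.2.1 hc) hne
  · rcases step₂ (r.avail₂ k) ht with ⟨-, hl, hv⟩ | h
    · refine fun hc' => hc ?_
      simp only [Cyclic, hl, hv] at hc' ⊢
      rcases hc' with ⟨hl, hx | ⟨hb, hx, hy⟩⟩ | ⟨hl, hx, hxy⟩
      · exact Or.inl ⟨hl, Or.inl (le_self_add.trans_lt hx)⟩
      · refine Or.inl ⟨hl, ?_⟩
        rcases eq_zero_or_pos (r.move₂ k).delay with h0 | h0
        · rw [h0, add_zero] at hx hy
          exact Or.inr ⟨hb, hx, hy⟩
        · exact Or.inl (hx ▸ lt_add_of_pos_right _ h0)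
      · exact Or.inr ⟨hl, le_self_add.trans_lt hx, lt_of_add_lt_add_right hxy⟩
    · simp [Cyclic, h.2.2.2]

/-- The steps in the cycle: waiting, the edge to `l¹`, and the edge back to `l⁰`, for which `y > 1`
and `y` is reset. -/
theorem cyclic_succ {b : Prop} {r : automaton.game.Run} {k : ℕ}
    (hm : r.move₁ k ∈ cycleMoves b (r.state k)) (hc : Cyclic b (r.state k)) :
    Cyclic b (r.state (k + 1)) ∧
    (((r.state (k + 1)).loc = (r.state k).loc ∧
        (r.state (k + 1)).val 1 = (r.state k).val 1 + elapsed (r.move₁ k) (r.move₂ k)) ∨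
      ((r.state k).loc = 0 ∧ (r.state (k + 1)).loc = 1 ∧
        (r.state (k + 1)).val 1 = (r.state k).val 1 + elapsed (r.move₁ k) (r.move₂ k)) ∨
      ((r.state k).loc = 1 ∧ (r.state (k + 1)).loc = 0 ∧ (r.state (k + 1)).val 1 = 0 ∧
        1 < (r.state k).val 1 + elapsed (r.move₁ k) (r.move₂ k))) := by
  have hm0 := hm.2.2.1 hc
  have hm1 := hm.2.2.2 hc
  have hloc : (r.state k).loc = 0 ∨ (r.state k).loc = 1 := hc.imp And.left And.left
  have hact : (r.move₁ k).act ≠ none := by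
    rcases hloc with hl | hl
    · simp [(hm0 hl).1]
    · simp [(hm1 hl).1]
  rcases r.step k with ⟨-, hle, ht⟩ | ⟨hle, ht⟩
  · rw [elapsed, min_eq_left hle]
    obtain ⟨a, ha⟩ := Option.ne_none_iff_exists'.1 hact
    have hav := r.avail₁ k
    rw [show r.move₁ k = ⟨(r.move₁ k).delay, some a⟩ by rw [← ha]] at hav ht
    rcases step₁ hav ht with ⟨-, hl, -, hl', hx', hy'⟩ | ⟨-, hl, hg, hl', hx', hy'⟩ |
      ⟨rfl, hl, -⟩ | ⟨-, hl, -⟩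
    · refine ⟨Or.inr ⟨hl', ?_, ?_⟩, Or.inr (Or.inl ⟨hl, hl', hy'⟩)⟩
      · simp [hx']
      · rw [hx', hy']; exact (hm0 hl).2.1
    · refine ⟨Or.inl ⟨hl', Or.inl ?_⟩, Or.inr (Or.inr ⟨hl, hl', hy', hg⟩)⟩
      rw [hx']; exact (hm1 hl).2
    · simp [(hm0 hl).1] at ha
    · simp [hl] at hloc
  · replace hle := hle.resolve_left hact
    rw [elapsed, min_eq_right hle]
    rcases step₂ (r.avail₂ k) ht with ⟨-, hl, hv⟩ | h
    · refine ⟨?_, Or.inl ⟨hl, hv 1⟩⟩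
      rcases hc with ⟨hl0, hc⟩ | ⟨hl1, hx, hxy⟩
      · refine Or.inl ⟨hl.trans hl0, ?_⟩
        rw [hv, hv]
        rcases (hm0 hl0).2 with ⟨hy, hx | ⟨hb, hx, hd⟩⟩
        · exact Or.inl (lt_of_le_of_lt (by gcongr) hx)
        · rw [hd] at hle hy
          rw [le_antisymm hle zero_le, add_zero, add_zero]
          exact Or.inr ⟨hb, hx, by simpa using hy⟩
      · refine Or.inr ⟨hl.trans hl1, ?_, ?_⟩
        · rw [hv]
          exact lt_of_le_of_lt (by gcongr) (hm1 hl1).2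
        · rw [hv, hv]
          gcongr
    · refine absurd h.2.2.1 (not_lt.2 (le_trans (add_le_add_right hle _) ?_))
      rcases hloc with hl | hl
      · rcases (hm0 hl).2.2 with hx | ⟨-, hx, hd⟩
        · exact hx.le
        · simp [hx, hd]
      · exact (hm1 hl).2.le

theorem mem_avoid_of_cycleMoves {b : Prop} {r : automaton.game.Run}
    (hm : ∀ k, r.move₁ k ∈ cycleMoves b (r.state k)) (h0 : Cyclic b (r.state 0)) : r ∈ avoid := by
  have hc : ∀ k, Cyclic b (r.state k) := fun k => by
    induction k with
    | zero => exact h0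
    | succ k ih => exact (cyclic_succ (hm k) ih).1
  intro k hk
  rcases hc k with h | h <;> simp [hk] at h

/-- Either the cycle is left, and then player 1 only waits, or each return to `l⁰` takes more than
one time unit of `y`, so that infinitely many moves of player 1 need infinite time. -/
theorem timeDiv_or_blameless_of_cycleMoves {b : Prop} {r : automaton.game.Run}
    (hm : ∀ k, r.move₁ k ∈ cycleMoves b (r.state k)) :
    r ∈ automaton.game.timeDiv ∪ automaton.game.blameless₁ := by
  classical
  by_cases hex : ∃ j, ¬ Cyclic b (r.state j)
  · obtain ⟨j, hj⟩ := hex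
    have hc : ∀ k ≥ j, ¬ Cyclic b (r.state k) := fun k hk => by
      induction k, hk using Nat.le_induction with
      | base => exact hj
      | succ k _ ih => exact not_cyclic_succ (hm k) ih
    exact Or.inr ⟨j, fun k hk hb => hb.2.2 ((hm k).2.1 (hc k hk))⟩
  push Not at hex
  by_cases hb : r ∈ automaton.game.blameless₁
  · exact Or.inr hb
  left
  let p : ℕ → Prop := fun k => automaton.game.Blame₁ (r.state k) (r.move₁ k) (r.move₂ k)
    (r.state (k + 1))
  have hfreq : ∃ᶠ k in atTop, p k := fun hne => by
    obtain ⟨k, hk⟩ := eventually_atTop.1 hne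
    exact hb ⟨k, hk⟩
  have hloc : ∀ k, p k → (r.state (k + 1)).loc ≠ (r.state k).loc := by
    rintro k ⟨-, ht, hact⟩ hl
    obtain ⟨a, ha⟩ := Option.ne_none_iff_exists'.1 hact
    have hav := r.avail₁ k
    rw [show r.move₁ k = ⟨(r.move₁ k).delay, some a⟩ by rw [← ha]] at hav ht
    rcases step₁ hav ht.symm with h | h | h | h <;> simp_all
  -- Each of the two edges of the cycle accounts for half of the time unit lost by resetting `y`.
  have hcount : ∀ k, (1 / 2 : ℝ) * Nat.count p k + (r.state k).val 1 ≤
      r.time k + (r.state 0).val 1 + if (r.state k).loc = 1 then 1 / 2 else 0 := by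
    intro k
    induction k with
    | zero =>
      have : (0 : ℝ) ≤ if (r.state 0).loc = 1 then 1 / 2 else 0 := by split_ifs <;> norm_num
      simpa [Run.time] using this
    | succ k ih =>
      have hle : (Nat.count p (k + 1) : ℝ) ≤ Nat.count p k + 1 := by
        rw [Nat.count_succ]
        split_ifs <;> push_cast <;> linarith
      rw [r.time_succ]
      push_cast
      rcases (cyclic_succ (hm k) (hex k)).2 with ⟨hl, hy⟩ | ⟨hl, hl', hy⟩ | ⟨hl, hl', hy, hgt⟩
      · have hnp : ¬ p k := fun h => hloc k h hl
        rw [Nat.count_succ, if_neg hnp, hl, hy]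
        push_cast
        linarith
      · simp only [hl, hl', hy] at ih ⊢
        push_cast at ih ⊢
        norm_num at ih ⊢
        linarith
      · have hgt' : (1 : ℝ) < (r.state k).val 1 + elapsed (r.move₁ k) (r.move₂ k) := by
          exact_mod_cast hgt
        simp only [hl, hl', hy] at ih ⊢
        norm_num at ih ⊢
        linarith
  refine r.mem_timeDiv_of_count hfreq (c := 1 / 2) (by norm_num) ((r.state 0).val 1 + 1 / 2)
    fun k => ?_
  have hif : (if (r.state k).loc = 1 then 1 / 2 else 0 : ℝ) ≤ 1 / 2 := by split_ifs <;> norm_num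
  have hy : (0 : ℝ) ≤ (r.state k).val 1 := ((r.state k).val 1).2
  linarith [hcount k]

theorem mem_robWinTimeDiv {s : automaton.State} (hs : Cyclic False s) :
    s ∈ automaton.game.robWinTimeDiv avoid := by
  choose mv hnd hsub using exists_robMove
  let π : automaton.game.RobStrategy :=
    { move := fun h => mv h.last
      avail := fun r k => by
        rw [r.last_pre]
        exact ⟨hnd _, fun m hm => (hsub _ hm).1⟩ }
  have hout : ∀ π₂ s, ∀ r ∈ robOutcomes s π π₂, ∀ k, r.move₁ k ∈ cycleMoves False (r.state k) :=
    fun π₂ s r hr k => hsub _ (r.last_pre k ▸ hr.2.1 k)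
  exact ⟨π, fun π₂ s r hr => timeDiv_or_blameless_of_cycleMoves (hout π₂ s r hr),
    fun π₂ _ r hr => mem_avoid_of_cycleMoves (hout π₂ s r hr) (hr.1.symm ▸ hs)⟩

theorem mem_winTimeDiv {s : automaton.State} (hs : Cyclic True s) :
    s ∈ automaton.game.winTimeDiv avoid := by
  choose mv hmv using exists_exactMove
  let π : automaton.game.Strategy₁ :=
    { move := fun h => mv h.last
      avail := fun r k => by
        rw [r.last_pre]
        exact (hmv _).1 }
  have hout : ∀ π₂ s, ∀ r ∈ outcomes s π π₂, ∀ k, r.move₁ k ∈ cycleMoves True (r.state k) := by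
    intro π₂ s r hr k
    rw [hr.2.1, show π.move (r.pre k) = mv (r.pre k).last from rfl, r.last_pre]
    exact hmv _
  exact ⟨π, fun π₂ s r hr => timeDiv_or_blameless_of_cycleMoves (hout π₂ s r hr),
    fun π₂ _ r hr => mem_avoid_of_cycleMoves (hout π₂ s r hr) (hr.1.symm ▸ hs)⟩

theorem init_zero_mem : init 0 ∈ automaton.game.robWinTimeDiv avoid :=
  mem_robWinTimeDiv (Or.inl ⟨rfl, Or.inl zero_lt_one⟩)

theorem init_one_mem : init 1 ∈ automaton.game.winTimeDiv avoid :=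
  mem_winTimeDiv (Or.inl ⟨rfl, Or.inr ⟨trivial, rfl, zero_lt_one⟩⟩)

end TimedGames.Example

theorem mainTheorem4 :
    (∀ (L C A₁ A₂ : Type*) [Finite L] [Finite C]
        (T : TimedGames.TimedAutomaton L C A₁ A₂) (Φ : Set T.game.Run)
        (ε ρ : NNReal), 0 < ε →
          T.game.jrWinTimeDiv ε ρ Φ ⊆ T.game.robWinTimeDiv Φ ∧
          T.game.robWinTimeDiv Φ ⊆ T.game.winTimeDiv Φ) ∧
    (TimedGames.Example.automaton.game.WellFormed ∧
      TimedGames.Example.avoid =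
        TimedGames.Example.automaton.game.parity TimedGames.Example.index ∧
      (∀ ε ρ : NNReal, 0 < ε →
        TimedGames.Example.automaton.game.jrWinTimeDiv ε ρ TimedGames.Example.avoid ⊂
          TimedGames.Example.automaton.game.robWinTimeDiv TimedGames.Example.avoid ∧
        TimedGames.Example.init 0 ∈
          TimedGames.Example.automaton.game.robWinTimeDiv TimedGames.Example.avoid \
          TimedGames.Example.automaton.game.jrWinTimeDiv ε ρ TimedGames.Example.avoid) ∧
      TimedGames.Example.automaton.game.robWinTimeDiv TimedGames.Example.avoid ⊂
        TimedGames.Example.automaton.game.winTimeDiv TimedGames.Example.avoid ∧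
      TimedGames.Example.init 1 ∈
        TimedGames.Example.automaton.game.winTimeDiv TimedGames.Example.avoid \
        TimedGames.Example.automaton.game.robWinTimeDiv TimedGames.Example.avoid) := by
  refine ⟨fun L C A₁ A₂ _ _ T Φ ε ρ hε => ⟨TimedGames.TimedGame.jrWinTimeDiv_subset ρ hε Φ,
      TimedGames.TimedGame.robWinTimeDiv_subset Φ⟩,
    TimedGames.Example.wellFormed, TimedGames.Example.avoid_eq_parity, fun ε ρ hε => ?_, ?_,
    TimedGames.Example.init_one_mem, TimedGames.Example.init_one_not_mem⟩
  · exact ⟨(Set.ssubset_iff_of_subset (TimedGames.TimedGame.jrWinTimeDiv_subset ρ hε _)).2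
      ⟨_, TimedGames.Example.init_zero_mem, TimedGames.Example.not_mem_jrWinTimeDiv ρ hε _⟩,
      TimedGames.Example.init_zero_mem, TimedGames.Example.not_mem_jrWinTimeDiv ρ hε _⟩
  · exact (Set.ssubset_iff_of_subset (TimedGames.TimedGame.robWinTimeDiv_subset _)).2
      ⟨_, TimedGames.Example.init_one_mem, TimedGames.Example.init_one_not_mem⟩
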